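/- Let $G$ be a finite group with exponent $n_1$. For $g\in G$ let $A_g$ be the $(0,1)$-matrix with rows and columns indexed by $G$ such that $(A_g)_{a,b}=1$ if and only if $ba^{-1}=g$, and let $\mathcal A=\{\sum_{g\in K}A_g : K \text{ a conjugacy class of } G\}$ be the conjugacy class scheme of $G$. Let $L=\mathbb Q(\zeta_{n_1})\subset\mathbb C$ with $\zeta_{n_1}=e^{2\pi i/n_1}$, let $F$ be a subfield of $L$, let $\phi:\mathbb Z_{n_1}^*\to \mathrm{Gal}(L/\mathbb Q)$ be the isomorphism sending $k$ to the automorphism $\tau_k$ with $\tau_k(\zeta_{n_1})=\zeta_{n_1}^k$, and put $Z_F=\phi^{-1}(\mathrm{Gal}(L/F))$. Let $L[\mathcal A]$ be the $L$-span of $\mathcal A$, and let $\mathcal F$ be the set of matrices in $L[\mathcal A]$ all of whose entries and all of whose eigenvalues lie in $F$. For $g,h\in G$ write $g\sim_F h$ if and only if $g$ is conjugate to $h^k$ for some $k\in Z_F$. Then $\sim_F$ is an equivalence relation on $G$, the matrices $B_{[g]_F}=\sum_{h\sim_F g}A_h$, one for each equivalence class $[g]_F$ of $\sim_F$, form a subscheme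 $\mathcal B$ of the association scheme $\mathcal A$ (that is, an association scheme obtained by merging classes of $\mathcal A$), and $\mathcal F=F[\mathcal B]$, the $F$-span of $\mathcal B$. In particular, let $C\subseteq G$ be a union of conjugacy classes, and let $X(G,C)$ be the normal Cayley digraph with vertex set $G$ and an arc from $a$ to $b$ if and only if $ba^{-1}\in C$. Then all eigenvalues of (the adjacency matrix of) $X(G,C)$ lie in $F$ if and only if $C$ is a union of equivalence classes of $\sim_F$. -/

import Mathlib

open scoped Matrix

noncomputable section

namespace GroupScheme

/-! ### Association schemes and their subschemes -/

section Scheme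

variable {V : Type*} [Fintype V] [DecidableEq V]

/-- A (commutative) association scheme on the vertex set `V`: a finite set of distinct nonzero
`(0,1)`-matrices that contains the identity, sums to the all-ones matrix, is closed under
transposition, commutes, and whose complex span is closed under multiplication. -/
structure IsAssociationScheme (S : Finset (Matrix V V ℂ)) : Prop where
  zero_or_one : ∀ A ∈ S, ∀ a b, A a b = 0 ∨ A a b = 1
  ne_zero : ∀ A ∈ S, A ≠ 0
  one_mem : 1 ∈ S
  sum_eq : ∑ A ∈ S, A = Matrix.of fun _ _ => 1
  transpose_mem : ∀ A ∈ S, Aᵀ ∈ S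
  mul_comm : ∀ A ∈ S, ∀ B ∈ S, A * B = B * A
  mul_mem_span : ∀ A ∈ S, ∀ B ∈ S, A * B ∈ Submodule.span ℂ (S : Set (Matrix V V ℂ))

open Classical in
/-- `T` is a subscheme (fusion scheme) of the association scheme `S`: both are association schemes
and `T` arises by merging the classes of `S` along a partition in which the identity is a part by
itself. -/
def IsSubscheme (T S : Finset (Matrix V V ℂ)) : Prop :=
  IsAssociationScheme S ∧ IsAssociationScheme T ∧
    ∃ P : Finpartition S, {1} ∈ P.parts ∧ T = P.parts.image fun c => ∑ A ∈ c, A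

/-- All (complex) eigenvalues of the matrix `M` lie in the set `F`. -/
def EigenvaluesIn (M : Matrix V V ℂ) (F : Set ℂ) : Prop :=
  ∀ μ : ℂ, Module.End.HasEigenvalue (Matrix.toLin' M) μ → μ ∈ F

/-- The matrices in `L[S]` all of whose entries and eigenvalues lie in `F`. -/
def matricesOver (L F : IntermediateField ℚ ℂ) (S : Finset (Matrix V V ℂ)) :
    Set (Matrix V V ℂ) :=
  {M | M ∈ Submodule.span L (S : Set (Matrix V V ℂ)) ∧ (∀ a b, M a b ∈ F) ∧
    EigenvaluesIn M (F : Set ℂ)}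

end Scheme

/-! ### Cyclotomic fields -/

section Cyclotomic

variable (n : ℕ) [NeZero n]

/-- The standard primitive `n`-th root of unity `exp (2πi/n)`. -/
def zeta : ℂ := Complex.exp (2 * Real.pi * Complex.I / n)

/-- The cyclotomic field `ℚ(ζₙ)` inside `ℂ`. -/
def cyclo : IntermediateField ℚ ℂ := IntermediateField.adjoin ℚ {zeta n}

theorem zeta_isPrimitiveRoot : IsPrimitiveRoot (zeta n) n :=
  Complex.isPrimitiveRoot_exp n (NeZero.ne n)

set_option linter.unusedSectionVars false in
theorem zeta_mem_cyclo : zeta n ∈ cyclo n :=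
  IntermediateField.mem_adjoin_simple_self ℚ (zeta n)

instance : IsCyclotomicExtension {n} ℚ (cyclo n) := by
  have hint : IsIntegral ℚ (zeta n) := (zeta_isPrimitiveRoot n).isIntegral (NeZero.pos n) |>.tower_top
  change IsCyclotomicExtension {n} ℚ (IntermediateField.adjoin ℚ {zeta n}).toSubalgebra
  rw [IntermediateField.adjoin_simple_toSubalgebra_of_isAlgebraic hint.isAlgebraic]
  exact (zeta_isPrimitiveRoot n).adjoin_isCyclotomicExtension ℚ

/-- The isomorphism `φ : (ℤ/n)ˣ ≃ Gal(ℚ(ζₙ)/ℚ)` sending `k` to `τ_k`, where `τ_k ζₙ = ζₙ ^ k`. -/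
def phi : (ZMod n)ˣ ≃* Gal(cyclo n/ℚ) :=
  (IsCyclotomicExtension.autEquivPow (cyclo n)
    (Polynomial.cyclotomic.irreducible_rat (NeZero.pos n))).symm

/-- `phi` is indeed the isomorphism with `φ(k) ζₙ = ζₙ ^ k`. -/
theorem phi_apply_zeta (k : (ZMod n)ˣ) :
    phi n k ⟨zeta n, zeta_mem_cyclo n⟩ = ⟨zeta n, zeta_mem_cyclo n⟩ ^ (k : ZMod n).val := by
  have : NumberField (cyclo n) := IsCyclotomicExtension.numberField {n} ℚ (cyclo n)
  have h := IsCyclotomicExtension.Rat.galEquivZMod_apply_of_pow_eq n (cyclo n) (phi n k)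
    (x := ⟨zeta n, zeta_mem_cyclo n⟩) (Subtype.ext (zeta_isPrimitiveRoot n).pow_eq_one)
  have hk : IsCyclotomicExtension.Rat.galEquivZMod n (cyclo n) (phi n k) = k :=
    MulEquiv.apply_symm_apply _ k
  rw [h, hk]

/-- For a subfield `F` of `ℚ(ζₙ)`, the subgroup `Z_F = φ⁻¹(Gal(ℚ(ζₙ)/F))` of `(ℤ/n)ˣ`. -/
def ZF {F : IntermediateField ℚ ℂ} (hF : F ≤ cyclo n) : Subgroup (ZMod n)ˣ :=
  (IntermediateField.restrict hF).fixingSubgroup.comap (phi n).toMonoidHom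

end Cyclotomic

/-! ### The conjugacy class scheme and normal Cayley digraphs -/

section Group

variable {G : Type*} [Group G]

/-- `C` is a union of classes `{h | r h g}` of the relation `r`. -/
def IsUnionOfClasses (r : G → G → Prop) (C : Set G) : Prop :=
  ∃ T : Set G, C = ⋃ g ∈ T, {h | r h g}

open Classical in
/-- The permutation matrix `A_g`: the `(a, b)` entry is `1` iff `b a⁻¹ = g`. -/
def permMat (g : G) : Matrix G G ℂ := Matrix.of fun a b => if b * a⁻¹ = g then 1 else 0

open Classical in
/-- The matrices `∑_{h : r h g} A_h`, one for each class of `r`. -/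
def classMatrices [Fintype G] (r : G → G → Prop) : Finset (Matrix G G ℂ) :=
  Finset.univ.image fun g : G => ∑ h : G with r h g, permMat h

variable (G) in
/-- The conjugacy class scheme of `G`. -/
def conjScheme [Fintype G] : Finset (Matrix G G ℂ) := classMatrices (IsConj : G → G → Prop)

/-- `g ∼_F h` iff `g` is conjugate to `h ^ k` for some `k ∈ Z_F`. -/
def SimF [Finite G] {F : IntermediateField ℚ ℂ} (hF : F ≤ cyclo (Monoid.exponent G)) (g h : G) :
    Prop :=
  ∃ k ∈ ZF (Monoid.exponent G) hF, IsConj g (h ^ (k : ZMod (Monoid.exponent G)).val)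

/-- The Cayley digraph `X(G, C)`, with an arc from `a` to `b` iff `b a⁻¹ ∈ C`. -/
def cayleyDigraph (C : Set G) : Digraph G := ⟨fun a b => b * a⁻¹ ∈ C⟩

end Group

open Classical in
/-- The `(0,1)` adjacency matrix of a digraph. -/
def adjacencyMatrix {V : Type*} (X : Digraph V) : Matrix V V ℂ :=
  Matrix.of fun a b => if X.Adj a b then 1 else 0

end GroupScheme

end

open scoped Matrix

noncomputable section

/-! Class functions on `G` correspond to the matrices invariant under left and right translation.
These form a commutative algebra closed under conjugate transpose, so its members are normal and it
is reduced. Hence every eigenvalue μ of a member M has a nonzero idempotent E in the algebra with M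
E = μ E, and μ = tr(M E) / tr E with tr E a positive integer. The central fact is
`cycloMap_idempotent`: τ_k sends E(1, g) to E(1, g^k). Indeed |G| E(1, g^j) is the trace of E times
a j-th power of a permutation matrix, which is Σ t_i ζ^(ij) with natural multiplicities t_i not
depending on j. For M with entries in F and k in Z_F, it follows that τ_k(tr(M E)) = tr(M' E), where
M' is M twisted by the k-th power map. Thus all eigenvalues of M lie in F exactly when M' = M for
every such k (`eigenvaluesIn_iff`), that is, when M is constant on the classes of ∼_F. This settles
the span and the Cayley digraphs. It also makes the merged classes a scheme: commuting matrices with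
eigenvalues in F have a product with eigenvalues in F. -/

namespace GroupScheme

/-! ### Spectral idempotents, traces and eigenvalues of complex matrices. -/

section Idempotents

variable {V : Type*} [Fintype V] [DecidableEq V]

/-- The trace of a projection is its rank. Integrality matters because the Galois action fixes
natural numbers. -/
theorem exists_trace_eq_natCast_of_isIdempotentElem {E : Matrix V V ℂ} (hE : IsIdempotentElem E) :
    ∃ t : ℕ, E.trace = t := by
  have h : IsIdempotentElem (Matrix.toLin' E) := by
    rw [IsIdempotentElem, Module.End.mul_eq_comp, ← Matrix.toLin'_mul, hE.eq]
  refine ⟨Module.finrank ℂ (LinearMap.range (Matrix.toLin' E)), ?_⟩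
  rw [← (LinearMap.IsIdempotentElem.isProj_range _ h).trace, Matrix.trace_toLin'_eq]

theorem trace_ne_zero_of_isIdempotentElem {E : Matrix V V ℂ} (hE : IsIdempotentElem E)
    (h0 : E ≠ 0) : E.trace ≠ 0 := by
  have h : IsIdempotentElem (Matrix.toLin' E) := by
    rw [IsIdempotentElem, Module.End.mul_eq_comp, ← Matrix.toLin'_mul, hE.eq]
  intro ht
  apply h0
  have := (LinearMap.IsIdempotentElem.trace_eq_zero_iff h).1
    (by rw [Matrix.trace_toLin'_eq, ht])
  simpa using this

open scoped ComplexOrder in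
omit [DecidableEq V] in
/-- A normal matrix whose square vanishes is zero. -/
theorem eq_zero_of_sq_eq_zero_of_normal {Y : Matrix V V ℂ} (hY : Yᴴ * Y = Y * Yᴴ)
    (h : Y * Y = 0) : Y = 0 := by
  -- Normality brings the two factors Y together; positivity of X ↦ XᴴX is then used twice, for YᴴY
  -- and for Y.
  have h1 : (Yᴴ * Y)ᴴ * (Yᴴ * Y) = 0 := by
    rw [Matrix.conjTranspose_mul, Matrix.conjTranspose_conjTranspose]
    calc Yᴴ * Y * (Yᴴ * Y) = Yᴴ * (Y * Yᴴ) * Y := by simp only [Matrix.mul_assoc]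
      _ = Yᴴ * Yᴴ * (Y * Y) := by rw [← hY]; simp only [Matrix.mul_assoc]
      _ = 0 := by rw [h, Matrix.mul_zero]
  exact Matrix.conjTranspose_mul_self_eq_zero.1 (Matrix.conjTranspose_mul_self_eq_zero.1 h1)

/-- In a reduced commutative algebra of matrices, every eigenvalue has a nonzero spectral
idempotent. -/
theorem exists_spectral_idempotent (A : Subalgebra ℂ (Matrix V V ℂ))
    (hred : ∀ Y ∈ A, Y * Y = 0 → Y = 0) {N : Matrix V V ℂ} (hN : N ∈ A) {μ : ℂ}
    (hμ : Module.End.HasEigenvalue (Matrix.toLin' N) μ) :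
    ∃ E ∈ A, IsIdempotentElem E ∧ E ≠ 0 ∧ N * E = μ • E := by
  have hroot := Module.End.isRoot_of_hasEigenvalue hμ
  rw [Matrix.minpoly_toLin'] at hroot
  have hint : IsIntegral ℂ N := Matrix.isIntegral N
  -- With q = minpoly / (X - μ), the idempotent is q(N) / q(μ).
  obtain ⟨q, hq⟩ := Polynomial.dvd_iff_isRoot.2 hroot
  have hmem : ∀ p : Polynomial ℂ, Polynomial.aeval N p ∈ A := fun p =>
    Algebra.adjoin_le (Set.singleton_subset_iff.2 hN) (Polynomial.aeval_mem_adjoin_singleton ℂ N)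
  have hne : minpoly ℂ N ≠ 0 := minpoly.ne_zero hint
  have hq0 : q ≠ 0 := by rintro rfl; exact hne (by rw [hq, mul_zero])
  have hdeg : (minpoly ℂ N).natDegree = q.natDegree + 1 := by
    rw [hq, Polynomial.natDegree_mul (Polynomial.X_sub_C_ne_zero μ) hq0,
      Polynomial.natDegree_X_sub_C, add_comm]
  have hqN : Polynomial.aeval N q ≠ 0 := by
    intro h
    have := Polynomial.natDegree_le_of_dvd (minpoly.dvd ℂ N h) hq0
    omega
  have hann : N * Polynomial.aeval N q = μ • Polynomial.aeval N q := by
    have h := minpoly.aeval ℂ N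
    rw [hq, map_mul, map_sub, Polynomial.aeval_X, Polynomial.aeval_C, sub_mul, sub_eq_zero] at h
    rw [h, ← Algebra.smul_def]
  have hact : ∀ p : Polynomial ℂ,
      Polynomial.aeval N p * Polynomial.aeval N q = p.eval μ • Polynomial.aeval N q := by
    intro p
    obtain ⟨s, hs⟩ := Polynomial.X_sub_C_dvd_sub_C_eval (a := μ) (p := p)
    have : p = s * (Polynomial.X - Polynomial.C μ) + Polynomial.C (p.eval μ) := by
      rw [mul_comm, ← hs]; ring
    conv_lhs => rw [this]
    rw [map_add, map_mul, map_sub, Polynomial.aeval_X, Polynomial.aeval_C, Polynomial.aeval_C,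
      add_mul, mul_assoc, sub_mul, hann, ← Algebra.smul_def, sub_self, mul_zero, zero_add,
      ← Algebra.smul_def]
  -- Since q(N)² = q(μ) q(N), a zero of q at μ would contradict reducedness.
  have hqμ : q.eval μ ≠ 0 := by
    intro h
    exact hqN (hred _ (hmem q) (by rw [hact, h, zero_smul]))
  refine ⟨(q.eval μ)⁻¹ • Polynomial.aeval N q, A.smul_mem (hmem q) _, ?_, ?_, ?_⟩
  · rw [IsIdempotentElem, Matrix.smul_mul, Matrix.mul_smul, hact, smul_smul _ (q.eval μ),
      inv_mul_cancel₀ hqμ, one_smul]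
  · exact smul_ne_zero (inv_ne_zero hqμ) hqN
  · rw [Matrix.mul_smul, hann, smul_comm]

/-- A matrix all of whose eigenvalues vanish is nilpotent. -/
theorem isNilpotent_of_eigenvalues_eq_zero {N : Matrix V V ℂ}
    (h : ∀ μ, Module.End.HasEigenvalue (Matrix.toLin' N) μ → μ = 0) : IsNilpotent N := by
  have hs : N.charpoly.roots = Multiset.replicate N.charpoly.roots.card 0 := by
    refine Multiset.eq_replicate_card.2 fun μ hμ => h μ ?_
    rw [Module.End.hasEigenvalue_iff_isRoot_charpoly, Matrix.charpoly_toLin']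
    exact Polynomial.isRoot_of_mem_roots hμ
  have hp := (IsAlgClosed.splits N.charpoly).eq_prod_roots_of_monic N.charpoly_monic
  rw [hs, Multiset.map_replicate, Multiset.prod_replicate, map_zero, sub_zero] at hp
  have := Matrix.aeval_self_charpoly N
  rw [hp, map_pow, Polynomial.aeval_X] at this
  exact ⟨_, this⟩

theorem eq_zero_of_eigenvalues_eq_zero (A : Subalgebra ℂ (Matrix V V ℂ))
    (hred : ∀ Y ∈ A, Y * Y = 0 → Y = 0) {N : Matrix V V ℂ} (hN : N ∈ A)
    (h : ∀ μ, Module.End.HasEigenvalue (Matrix.toLin' N) μ → μ = 0) : N = 0 := by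
  obtain ⟨m, hm⟩ := isNilpotent_of_eigenvalues_eq_zero h
  -- Reducedness is given for squares only, so the nilpotency exponent is raised to a power of 2 and
  -- halved repeatedly.
  have key : ∀ j, N ^ 2 ^ j = 0 → N = 0 := by
    intro j
    induction j with
    | zero => simp
    | succ j ih =>
      intro hj
      refine ih (hred _ (pow_mem hN _) ?_)
      rw [← pow_add, ← hj]
      congr 1
      ring
  exact key m (pow_eq_zero_of_le (Nat.lt_two_pow_self).le hm)

/-- If the eigenvalues of `M` lie in `F`, so does the trace of `M * E` for every idempotent `E`
commuting with `M`. -/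
theorem EigenvaluesIn.trace_mul_mem {F : IntermediateField ℚ ℂ} {M E : Matrix V V ℂ}
    (hM : EigenvaluesIn M (F : Set ℂ)) (hE : IsIdempotentElem E) (hc : M * E = E * M) :
    (M * E).trace ∈ F := by
  rw [Matrix.trace_eq_sum_roots_charpoly]
  refine multiset_sum_mem _ fun μ hμ => ?_
  have hev : Module.End.HasEigenvalue (Matrix.toLin' (M * E)) μ := by
    rw [Module.End.hasEigenvalue_iff_isRoot_charpoly, Matrix.charpoly_toLin']
    exact Polynomial.isRoot_of_mem_roots hμ
  obtain ⟨v, hv⟩ := hev.exists_hasEigenvector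
  have hv1 : (M * E) *ᵥ v = μ • v := by simpa using hv.apply_eq_smul
  by_cases h0 : μ = 0
  · rw [h0]; exact F.zero_mem
  refine hM μ (Module.End.hasEigenvalue_of_hasEigenvector (x := v)
    (Module.End.hasEigenvector_iff.2 ⟨Module.End.mem_eigenspace_iff.2 ?_, hv.2⟩))
  -- An eigenvector of M E with nonzero eigenvalue lies in the range of E, so it is an eigenvector
  -- of M.
  have hEv : E *ᵥ v = v := by
    have h2 : E *ᵥ (μ • v) = μ • v := by
      rw [← hv1, Matrix.mulVec_mulVec, hc, ← Matrix.mul_assoc, hE.eq]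
    rw [Matrix.mulVec_smul] at h2
    exact smul_right_injective _ h0 h2
  rw [Matrix.toLin'_apply]
  rw [← Matrix.mulVec_mulVec, hEv] at hv1
  exact hv1

/-- The eigenvalues of a product of commuting matrices over `F`-eigenvalues lie in `F`. -/
theorem EigenvaluesIn.mul {F : IntermediateField ℚ ℂ} {M N : Matrix V V ℂ}
    (hM : EigenvaluesIn M (F : Set ℂ)) (hN : EigenvaluesIn N (F : Set ℂ)) (hc : M * N = N * M) :
    EigenvaluesIn (M * N) (F : Set ℂ) := by
  intro μ hμ
  -- M preserves this eigenspace, so it has an eigenvector there; unless its eigenvalue α is 0, that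
  -- vector is an eigenvector of N too.
  let W := Module.End.eigenspace (Matrix.toLin' (M * N)) μ
  have hmaps : ∀ x ∈ W, Matrix.toLin' M x ∈ W := by
    intro x hx
    simp only [W, Module.End.mem_eigenspace_iff, Matrix.toLin'_apply] at hx ⊢
    rw [Matrix.mulVec_mulVec, Matrix.mul_assoc, ← hc, ← Matrix.mulVec_mulVec, hx,
      Matrix.mulVec_smul]
  have : Nontrivial W := (Submodule.nontrivial_iff_ne_bot).2 hμ
  obtain ⟨α, hα⟩ := Module.End.exists_eigenvalue ((Matrix.toLin' M).restrict hmaps)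
  obtain ⟨w, hw⟩ := hα.exists_hasEigenvector
  have hw0 : (w : V → ℂ) ≠ 0 := fun h => hw.2 (Subtype.ext h)
  have hMw : M *ᵥ (w : V → ℂ) = α • (w : V → ℂ) := by
    have := congrArg Subtype.val hw.apply_eq_smul
    simpa using this
  have hMN : (N * M) *ᵥ (w : V → ℂ) = μ • (w : V → ℂ) := by
    have := Module.End.mem_eigenspace_iff.1 w.2
    rwa [hc, Matrix.toLin'_apply] at this
  rw [← Matrix.mulVec_mulVec, hMw, Matrix.mulVec_smul] at hMN
  by_cases h0 : α = 0
  · rw [h0, zero_smul] at hMN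
    rcases smul_eq_zero.1 hMN.symm with h | h
    · rw [h]; exact F.zero_mem
    · exact absurd h hw0
  · have hNw : N *ᵥ (w : V → ℂ) = (α⁻¹ * μ) • (w : V → ℂ) := by
      rw [mul_smul, ← hMN, smul_smul, inv_mul_cancel₀ h0, one_smul]
    have h1 : α ∈ F := hM α (Module.End.hasEigenvalue_of_hasEigenvector (x := (w : V → ℂ))
      (Module.End.hasEigenvector_iff.2 ⟨Module.End.mem_eigenspace_iff.2 (by simpa using hMw), hw0⟩))
    have h2 : α⁻¹ * μ ∈ F := hN _ (Module.End.hasEigenvalue_of_hasEigenvector (x := (w : V → ℂ))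
      (Module.End.hasEigenvector_iff.2 ⟨Module.End.mem_eigenspace_iff.2 (by simpa using hNw), hw0⟩))
    have h3 := F.mul_mem h1 h2
    rwa [← mul_assoc, mul_inv_cancel₀ h0, one_mul] at h3

end Idempotents

/-! ### Fourier decomposition of an element of finite order. -/

section RootOfUnity

variable {R : Type*} [Ring R] [Algebra ℂ R]

/-- The projection onto the `ζ ^ i`-eigenspace of an element of order dividing `n`. -/
def fourierIdempotent (n : ℕ) (ζ : ℂ) (x : R) (i : ℕ) : R :=
  (n : ℂ)⁻¹ • ∑ j ∈ Finset.range n, ((ζ ^ i)⁻¹) ^ j • x ^ j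

theorem mul_fourierIdempotent {n : ℕ} {ζ : ℂ} (hζ : IsPrimitiveRoot ζ n) (hn : n ≠ 0) {x : R}
    (hx : x ^ n = 1) (i : ℕ) :
    x * fourierIdempotent n ζ x i = ζ ^ i • fourierIdempotent n ζ x i := by
  have h0 : ζ ^ i ≠ 0 := pow_ne_zero _ (hζ.ne_zero hn)
  have hn' : ((ζ ^ i)⁻¹) ^ n = 1 := by rw [inv_pow, ← pow_mul, mul_comm, pow_mul, hζ.pow_eq_one]; simp
  rw [fourierIdempotent, mul_smul_comm, smul_comm (ζ ^ i)]
  congr 1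
  rw [Finset.mul_sum, Finset.smul_sum]
  -- Multiplication by x shifts the index cyclically: the terms for j = 0 and j = n coincide.
  have h := (Finset.sum_range_succ (fun j => ζ ^ i • (((ζ ^ i)⁻¹) ^ j • x ^ j)) n).symm.trans
    (Finset.sum_range_succ' (fun j => ζ ^ i • (((ζ ^ i)⁻¹) ^ j • x ^ j)) n)
  rw [hn', hx, pow_zero, pow_zero] at h
  rw [add_right_cancel h]
  refine Finset.sum_congr rfl fun j _ => ?_
  rw [mul_smul_comm, ← pow_succ', smul_smul, pow_succ' (ζ ^ i)⁻¹, ← mul_assoc, mul_inv_cancel₀ h0,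
    one_mul]

theorem pow_mul_fourierIdempotent {n : ℕ} {ζ : ℂ} (hζ : IsPrimitiveRoot ζ n) (hn : n ≠ 0) {x : R}
    (hx : x ^ n = 1) (i k : ℕ) :
    x ^ k * fourierIdempotent n ζ x i = (ζ ^ i) ^ k • fourierIdempotent n ζ x i := by
  induction k with
  | zero => simp
  | succ k ih =>
    rw [pow_succ', mul_assoc, ih, mul_smul_comm, mul_fourierIdempotent hζ hn hx, smul_smul,
      ← pow_succ]

theorem isIdempotentElem_fourierIdempotent {n : ℕ} {ζ : ℂ} (hζ : IsPrimitiveRoot ζ n) (hn : n ≠ 0)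
    {x : R} (hx : x ^ n = 1) (i : ℕ) : IsIdempotentElem (fourierIdempotent n ζ x i) := by
  have h0 : ζ ^ i ≠ 0 := pow_ne_zero _ (hζ.ne_zero hn)
  have hnC : (n : ℂ) ≠ 0 := Nat.cast_ne_zero.2 hn
  rw [IsIdempotentElem]
  conv_lhs => lhs; rw [fourierIdempotent]
  rw [smul_mul_assoc, Finset.sum_mul]
  have : ∀ j ∈ Finset.range n, ((ζ ^ i)⁻¹ ^ j • x ^ j) * fourierIdempotent n ζ x i =
      fourierIdempotent n ζ x i := fun j _ => by
    rw [smul_mul_assoc, pow_mul_fourierIdempotent hζ hn hx, smul_smul, ← mul_pow,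
      inv_mul_cancel₀ h0, one_pow, one_smul]
  rw [Finset.sum_congr rfl this, Finset.sum_const, Finset.card_range, ← Nat.cast_smul_eq_nsmul ℂ,
    smul_smul, inv_mul_cancel₀ hnC, one_smul]

theorem sum_fourierIdempotent {n : ℕ} {ζ : ℂ} (hζ : IsPrimitiveRoot ζ n) (hn : n ≠ 0) (x : R) :
    ∑ i ∈ Finset.range n, fourierIdempotent n ζ x i = 1 := by
  have hnC : (n : ℂ) ≠ 0 := Nat.cast_ne_zero.2 hn
  simp only [fourierIdempotent]
  rw [← Finset.smul_sum, Finset.sum_comm, Finset.sum_eq_single_of_mem 0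
    (Finset.mem_range.2 (Nat.pos_of_ne_zero hn))]
  · simp only [pow_zero, one_smul, Finset.sum_const, Finset.card_range]
    rw [← Nat.cast_smul_eq_nsmul ℂ, smul_smul, inv_mul_cancel₀ hnC, one_smul]
  · intro j hj hj0
    rw [← Finset.sum_smul]
    have hpr : (ζ⁻¹) ^ j ≠ 1 := hζ.inv.pow_ne_one_of_pos_of_lt hj0 (Finset.mem_range.1 hj)
    have hs : ∑ i ∈ Finset.range n, ((ζ ^ i)⁻¹) ^ j = ∑ i ∈ Finset.range n, ((ζ⁻¹) ^ j) ^ i :=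
      Finset.sum_congr rfl fun i _ => by rw [← inv_pow, ← pow_mul, ← pow_mul, mul_comm]
    rw [hs, geom_sum_eq hpr, ← pow_mul, mul_comm, pow_mul, hζ.inv.pow_eq_one]
    simp

theorem pow_eq_sum_fourierIdempotent {n : ℕ} {ζ : ℂ} (hζ : IsPrimitiveRoot ζ n) (hn : n ≠ 0)
    {x : R} (hx : x ^ n = 1) (k : ℕ) :
    x ^ k = ∑ i ∈ Finset.range n, (ζ ^ i) ^ k • fourierIdempotent n ζ x i := by
  conv_lhs => rw [← mul_one (x ^ k), ← sum_fourierIdempotent hζ hn x, Finset.mul_sum]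
  exact Finset.sum_congr rfl fun i _ => pow_mul_fourierIdempotent hζ hn hx i k

end RootOfUnity

/-- The trace of `x ^ k * E` for a matrix `x` of order dividing `n` and an idempotent `E` commuting
with `x`. -/
theorem exists_trace_pow_mul_eq {V : Type*} [Fintype V] [DecidableEq V] {n : ℕ} {ζ : ℂ}
    (hζ : IsPrimitiveRoot ζ n) (hn : n ≠ 0) {x E : Matrix V V ℂ} (hx : x ^ n = 1)
    (hE : IsIdempotentElem E) (hc : Commute x E) :
    ∃ t : ℕ → ℕ, ∀ k, (x ^ k * E).trace = ∑ i ∈ Finset.range n, (ζ ^ i) ^ k * t i := by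
  -- A product of commuting idempotents is idempotent; its rank is the multiplicity of ζ^i on the
  -- range of E, the same for all k.
  have h : ∀ i, ∃ t : ℕ, (fourierIdempotent n ζ x i * E).trace = t := by
    intro i
    refine exists_trace_eq_natCast_of_isIdempotentElem
      (IsIdempotentElem.mul_of_commute ?_ (isIdempotentElem_fourierIdempotent hζ hn hx i) hE)
    exact (Commute.sum_left _ _ _ fun j _ => ((hc.pow_left j).smul_left _)).smul_left _
  choose t ht using h
  refine ⟨t, fun k => ?_⟩
  rw [pow_eq_sum_fourierIdempotent hζ hn hx, Finset.sum_mul, Matrix.trace_sum]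
  refine Finset.sum_congr rfl fun i _ => ?_
  rw [Matrix.smul_mul, Matrix.trace_smul, ht, smul_eq_mul]

/-! ### The commutative algebra of translation-invariant matrices. -/

section Biinvariant

variable {G : Type*} [Group G] [Fintype G] [DecidableEq G]

omit [DecidableEq G] in
-- The substitution x ↦ a x⁻¹ b exchanges the two sums. One-sided hypotheses suffice, so the lemma
-- also covers `permMat`, which is only right-invariant.
theorem mul_apply_comm_of_biinvariant {M N : Matrix G G ℂ}
    (hM : ∀ x a b, M (a * x) (b * x) = M a b) (hN : ∀ x a b, N (x * a) (x * b) = N a b) :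
    M * N = N * M := by
  ext a b
  rw [Matrix.mul_apply, Matrix.mul_apply]
  refine Fintype.sum_equiv
    (((Equiv.inv G).trans (Equiv.mulLeft a)).trans (Equiv.mulRight b)) _ _ fun x => ?_
  simp only [Equiv.trans_apply, Equiv.inv_apply, Equiv.coe_mulLeft, Equiv.coe_mulRight]
  have h1 : M (a * x⁻¹ * b) b = M a x := by
    have := hM (x⁻¹ * b) a x
    rwa [← mul_assoc, ← mul_assoc, mul_inv_cancel, one_mul] at this
  have h2 : N a (a * x⁻¹ * b) = N x b := by
    have := hN (a * x⁻¹) x b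
    rwa [inv_mul_cancel_right] at this
  rw [h1, h2, mul_comm]

variable (G) in
/-- The complex matrices indexed by `G` that are invariant under left and right translation. -/
def biinvariant : Subalgebra ℂ (Matrix G G ℂ) where
  carrier := {M | (∀ x a b, M (x * a) (x * b) = M a b) ∧ ∀ x a b, M (a * x) (b * x) = M a b}
  mul_mem' := by
    rintro M N ⟨hM, hM'⟩ ⟨hN, hN'⟩
    constructor
    · intro x a b
      rw [Matrix.mul_apply, Matrix.mul_apply]
      refine (Fintype.sum_equiv (Equiv.mulLeft x) _ _ fun y => ?_).symm
      rw [Equiv.coe_mulLeft, hM, hN]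
    · intro x a b
      rw [Matrix.mul_apply, Matrix.mul_apply]
      refine (Fintype.sum_equiv (Equiv.mulRight x) _ _ fun y => ?_).symm
      rw [Equiv.coe_mulRight, hM', hN']
  add_mem' := by
    rintro M N ⟨hM, hM'⟩ ⟨hN, hN'⟩
    exact ⟨fun x a b => by rw [Matrix.add_apply, Matrix.add_apply, hM, hN],
      fun x a b => by rw [Matrix.add_apply, Matrix.add_apply, hM', hN']⟩
  algebraMap_mem' := by
    intro r
    constructor <;> intro x a b <;> simp [Matrix.algebraMap_matrix_apply]

theorem biinvariant_comm {M N : Matrix G G ℂ} (hM : M ∈ biinvariant G) (hN : N ∈ biinvariant G) :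
    M * N = N * M :=
  mul_apply_comm_of_biinvariant hM.2 hN.1

theorem conjTranspose_mem_biinvariant {M : Matrix G G ℂ} (hM : M ∈ biinvariant G) :
    Mᴴ ∈ biinvariant G :=
  ⟨fun x a b => by simp only [Matrix.conjTranspose_apply, hM.1],
    fun x a b => by simp only [Matrix.conjTranspose_apply, hM.2]⟩

theorem eq_zero_of_mem_biinvariant_of_sq {Y : Matrix G G ℂ} (hY : Y ∈ biinvariant G)
    (h : Y * Y = 0) : Y = 0 :=
  eq_zero_of_sq_eq_zero_of_normal (biinvariant_comm (conjTranspose_mem_biinvariant hY) hY) h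

theorem apply_eq_of_mem_biinvariant {M : Matrix G G ℂ} (hM : M ∈ biinvariant G) (a b : G) :
    M a b = M 1 (b * a⁻¹) := by
  rw [← hM.2 a⁻¹ a b, mul_inv_cancel]

/-- `circulant m` has `(a, b)` entry `m (b a⁻¹)`. -/
def circulant (m : G → ℂ) : Matrix G G ℂ := Matrix.of fun a b => m (b * a⁻¹)

omit [Fintype G] [DecidableEq G] in
theorem circulant_apply (m : G → ℂ) (a b : G) : circulant m a b = m (b * a⁻¹) := rfl

theorem circulant_mem_biinvariant {m : G → ℂ} (hm : ∀ g h, IsConj g h → m g = m h) :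
    circulant m ∈ biinvariant G := by
  refine ⟨fun x a b => ?_, fun x a b => ?_⟩
  · rw [circulant_apply, circulant_apply]
    exact (hm _ _ (isConj_iff.2 ⟨x, by group⟩)).symm
  · rw [circulant_apply, circulant_apply]
    congr 1
    group

theorem eq_circulant_of_mem_biinvariant {M : Matrix G G ℂ} (hM : M ∈ biinvariant G) :
    M = circulant (M 1) := by
  ext a b
  exact apply_eq_of_mem_biinvariant hM a b

theorem apply_one_eq_of_isConj {M : Matrix G G ℂ} (hM : M ∈ biinvariant G) {g h : G}
    (hgh : IsConj g h) : M 1 g = M 1 h := by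
  obtain ⟨c, rfl⟩ := isConj_iff.1 hgh
  have := hM.1 c 1 g
  rw [mul_one, apply_eq_of_mem_biinvariant hM] at this
  exact this.symm

omit [Fintype G] [DecidableEq G] in
theorem permMat_apply (g a b : G) [Decidable (b * a⁻¹ = g)] :
    permMat g a b = if b * a⁻¹ = g then 1 else 0 := by
  simp [permMat]

theorem permMat_mul_apply (g : G) (M : Matrix G G ℂ) (a b : G) :
    (permMat g * M) a b = M (g * a) b := by
  rw [Matrix.mul_apply, Finset.sum_eq_single (g * a)]
  · simp [permMat_apply]
  · intro c _ hc
    rw [permMat_apply, if_neg, zero_mul]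
    rintro rfl
    simp at hc
  · simp

omit [Fintype G] in
theorem permMat_one : permMat (1 : G) = 1 := by
  ext a b
  simp [permMat_apply, Matrix.one_apply, mul_inv_eq_one, eq_comm]

theorem permMat_pow (g : G) (k : ℕ) : permMat g ^ k = permMat (g ^ k) := by
  induction k with
  | zero => simp [permMat_one]
  | succ k ih =>
    rw [pow_succ', ih]
    ext a b
    simp only [permMat_mul_apply, permMat_apply, mul_inv_rev, ← mul_assoc, mul_inv_eq_iff_eq_mul,
      pow_succ]

theorem commute_permMat {M : Matrix G G ℂ} (hM : M ∈ biinvariant G) (g : G) :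
    Commute (permMat g) M := by
  refine (mul_apply_comm_of_biinvariant (fun x a b => ?_) hM.1)
  rw [permMat_apply, permMat_apply]
  simp

/-- Recovers the entries of M from traces, to which the Fourier decomposition applies. -/
theorem trace_permMat_mul {M : Matrix G G ℂ} (hM : M ∈ biinvariant G) (g : G) :
    (permMat g * M).trace = Fintype.card G * M 1 g⁻¹ := by
  rw [Matrix.trace]
  simp only [Matrix.diag_apply, permMat_mul_apply]
  have : ∀ a, M (g * a) a = M 1 g⁻¹ := fun a => by
    rw [apply_eq_of_mem_biinvariant hM]; simp
  simp [this]

theorem trace_mul_eq {M E : Matrix G G ℂ} (hM : M ∈ biinvariant G) (hE : E ∈ biinvariant G) :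
    (M * E).trace = Fintype.card G * ∑ g, M 1 g * E 1 g⁻¹ := by
  have h := mul_mem hM hE
  rw [Matrix.trace]
  simp only [Matrix.diag_apply]
  have h1 : ∀ a, (M * E) a a = ∑ g, M 1 g * E 1 g⁻¹ := fun a => by
    rw [apply_eq_of_mem_biinvariant h, mul_inv_cancel, Matrix.mul_apply]
    refine Finset.sum_congr rfl fun g _ => ?_
    rw [apply_eq_of_mem_biinvariant hE g, one_mul]
  simp [h1]

end Biinvariant

/-! ### Galois action on the cyclotomic field. -/

section Galois

variable {n : ℕ} [NeZero n]

theorem mem_iff_phi_apply_eq {F : IntermediateField ℚ ℂ} (hF : F ≤ cyclo n) (y : cyclo n) :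
    (y : ℂ) ∈ F ↔ ∀ k ∈ ZF n hF, phi n k y = y := by
  have : NumberField (cyclo n) := IsCyclotomicExtension.numberField {n} ℚ (cyclo n)
  have hgal : IsGalois ℚ (cyclo n) := IsCyclotomicExtension.isGalois {n} ℚ (cyclo n)
  rw [← IntermediateField.mem_restrict hF y]
  constructor
  · intro hy k hk
    exact (IntermediateField.mem_fixingSubgroup_iff _ _).1 hk y hy
  · intro h
    rw [← @IsGalois.fixedField_fixingSubgroup ℚ _ (cyclo n) _ _ (IntermediateField.restrict hF)
      inferInstance hgal, IntermediateField.mem_fixedField_iff]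
    intro f hf
    obtain ⟨k, rfl⟩ := (phi n).surjective f
    exact h k hf

/-- `CycloMap k x y` says that `x` lies in the `n`-th cyclotomic field and is mapped to `y` by
`τ_k`. -/
def CycloMap (k : (ZMod n)ˣ) (x y : ℂ) : Prop :=
  ∃ z : cyclo n, (z : ℂ) = x ∧ (phi n k z : ℂ) = y

theorem CycloMap.mul {k : (ZMod n)ˣ} {x y x' y' : ℂ} (h : CycloMap k x y) (h' : CycloMap k x' y') :
    CycloMap k (x * x') (y * y') := by
  obtain ⟨z, rfl, rfl⟩ := h
  obtain ⟨z', rfl, rfl⟩ := h'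
  exact ⟨z * z', by simp, by simp⟩

theorem CycloMap.div {k : (ZMod n)ˣ} {x y x' y' : ℂ} (h : CycloMap k x y) (h' : CycloMap k x' y') :
    CycloMap k (x / x') (y / y') := by
  obtain ⟨z, rfl, rfl⟩ := h
  obtain ⟨z', rfl, rfl⟩ := h'
  exact ⟨z / z', by simp, by simp⟩

theorem CycloMap.pow {k : (ZMod n)ˣ} {x y : ℂ} (h : CycloMap k x y) (j : ℕ) :
    CycloMap k (x ^ j) (y ^ j) := by
  obtain ⟨z, rfl, rfl⟩ := h
  exact ⟨z ^ j, by simp, by simp⟩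

theorem CycloMap.sum {k : (ZMod n)ˣ} {ι : Type*} {s : Finset ι} {f g : ι → ℂ}
    (h : ∀ i ∈ s, CycloMap k (f i) (g i)) : CycloMap k (∑ i ∈ s, f i) (∑ i ∈ s, g i) := by
  classical
  induction s using Finset.induction_on with
  | empty => exact ⟨0, by simp, by simp⟩
  | insert a s ha ih =>
    obtain ⟨z, h1, h2⟩ := h a (Finset.mem_insert_self _ _)
    obtain ⟨w, h3, h4⟩ := ih fun i hi => h i (Finset.mem_insert_of_mem hi)
    rw [Finset.sum_insert ha, Finset.sum_insert ha]
    exact ⟨z + w, by simp [h1, h3], by simp [h2, h4]⟩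

theorem cycloMap_natCast (k : (ZMod n)ˣ) (t : ℕ) : CycloMap k t t := ⟨t, by simp, by simp⟩

theorem cycloMap_zeta (k : (ZMod n)ˣ) : CycloMap k (zeta n) (zeta n ^ (k : ZMod n).val) :=
  ⟨⟨zeta n, zeta_mem_cyclo n⟩, rfl, by rw [phi_apply_zeta]; simp⟩

/-- Allows two computations of the same Galois conjugate to be equated. -/
theorem CycloMap.right_unique {k : (ZMod n)ˣ} {x y y' : ℂ} (h : CycloMap k x y)
    (h' : CycloMap k x y') : y = y' := by
  obtain ⟨z, rfl, rfl⟩ := h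
  obtain ⟨z', h1, rfl⟩ := h'
  rw [Subtype.ext h1]

theorem cycloMap_self {F : IntermediateField ℚ ℂ} (hF : F ≤ cyclo n) {k : (ZMod n)ˣ}
    (hk : k ∈ ZF n hF) {x : ℂ} (hx : x ∈ F) : CycloMap k x x :=
  ⟨⟨x, hF hx⟩, rfl, by rw [(mem_iff_phi_apply_eq hF ⟨x, hF hx⟩).1 hx k hk]⟩

theorem mem_of_cycloMap_self {F : IntermediateField ℚ ℂ} (hF : F ≤ cyclo n) {x : ℂ}
    (h : ∀ k ∈ ZF n hF, CycloMap k x x) : x ∈ F := by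
  obtain ⟨z, rfl, -⟩ := h 1 (one_mem _)
  refine (mem_iff_phi_apply_eq hF z).2 fun k hk => ?_
  obtain ⟨w, h1, h2⟩ := h k hk
  rw [Subtype.ext h1] at h2
  exact Subtype.ext h2

end Galois

/-! ### Power maps on the group. -/

section Power

variable {G : Type*} [Group G]

/-- Reducing exponents modulo the exponent of `G` is harmless, since it is a multiple of every
element order. -/
theorem pow_val_mul (k l : (ZMod (Monoid.exponent G))ˣ) (g : G) :
    (g ^ (k : ZMod (Monoid.exponent G)).val) ^ (l : ZMod (Monoid.exponent G)).val =
      g ^ ((k * l : (ZMod (Monoid.exponent G))ˣ) : ZMod (Monoid.exponent G)).val := by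
  rw [← pow_mul, Units.val_mul, ZMod.val_mul]
  refine pow_eq_pow_iff_modEq.2 ?_
  exact ((Nat.mod_modEq _ _).symm).of_dvd (Monoid.order_dvd_exponent g)

theorem pow_val_one (g : G) :
    g ^ ((1 : (ZMod (Monoid.exponent G))ˣ) : ZMod (Monoid.exponent G)).val = g := by
  rw [Units.val_one, ZMod.val_one_eq_one_mod]
  conv_rhs => rw [← pow_one g]
  refine pow_eq_pow_iff_modEq.2 ?_
  exact (Nat.mod_modEq _ _).of_dvd (Monoid.order_dvd_exponent g)

/-- The power map `g ↦ g ^ k` for `k` prime to the exponent. -/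
def powEquiv (k : (ZMod (Monoid.exponent G))ˣ) : G ≃ G where
  toFun g := g ^ (k : ZMod (Monoid.exponent G)).val
  invFun g := g ^ ((k⁻¹ : (ZMod (Monoid.exponent G))ˣ) : ZMod (Monoid.exponent G)).val
  left_inv g := by beta_reduce; rw [pow_val_mul, mul_inv_cancel, pow_val_one]
  right_inv g := by beta_reduce; rw [pow_val_mul, inv_mul_cancel, pow_val_one]

theorem powEquiv_apply (k : (ZMod (Monoid.exponent G))ˣ) (g : G) :
    powEquiv k g = g ^ (k : ZMod (Monoid.exponent G)).val := rfl

theorem powEquiv_symm (k : (ZMod (Monoid.exponent G))ˣ) :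
    (powEquiv k : G ≃ G).symm = powEquiv k⁻¹ := rfl

theorem powEquiv_powEquiv (k l : (ZMod (Monoid.exponent G))ˣ) (g : G) :
    powEquiv l (powEquiv k g) = powEquiv (k * l) g := pow_val_mul k l g

theorem powEquiv_inv (k : (ZMod (Monoid.exponent G))ˣ) (g : G) :
    powEquiv k g⁻¹ = (powEquiv k g)⁻¹ := inv_pow g _

theorem powEquiv_one_right (k : (ZMod (Monoid.exponent G))ˣ) : powEquiv k (1 : G) = 1 :=
  one_pow _

theorem isConj_powEquiv (k : (ZMod (Monoid.exponent G))ˣ) {g h : G} (hgh : IsConj g h) :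
    IsConj (powEquiv k g) (powEquiv k h) := by
  obtain ⟨c, rfl⟩ := isConj_iff.1 hgh
  exact isConj_iff.2 ⟨c, by rw [powEquiv_apply, powEquiv_apply, conj_pow]⟩

end Power

/-! ### The criterion for eigenvalues in F. -/

section Criterion

variable {G : Type*} [Group G] [Fintype G] [DecidableEq G]

/-- The Galois action on the entries of an idempotent is given by the power maps. -/
theorem cycloMap_idempotent {E : Matrix G G ℂ} (hE : E ∈ biinvariant G) (hi : IsIdempotentElem E)
    (k : (ZMod (Monoid.exponent G))ˣ) (g : G) : CycloMap k (E 1 g) (E 1 (powEquiv k g)) := by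
  have hx : permMat g⁻¹ ^ Monoid.exponent G = 1 := by
    rw [permMat_pow, Monoid.pow_exponent_eq_one, permMat_one]
  obtain ⟨t, ht⟩ := exists_trace_pow_mul_eq (zeta_isPrimitiveRoot (Monoid.exponent G))
    (NeZero.ne _) hx hi (commute_permMat hE _)
  have hcard : (Fintype.card G : ℂ) ≠ 0 := Nat.cast_ne_zero.2 Fintype.card_ne_zero
  -- One family t serves every j, so τ_k, which raises each ζ^i to the k-th power, turns the formula
  -- for j = 1 into that for j = k.
  have hval : ∀ j, E 1 (g ^ j) = (∑ i ∈ Finset.range (Monoid.exponent G),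
      (zeta (Monoid.exponent G) ^ i) ^ j * t i) / Fintype.card G := by
    intro j
    rw [← ht, permMat_pow, trace_permMat_mul hE, mul_div_cancel_left₀ _ hcard]
    simp
  have h1 := hval 1
  rw [pow_one] at h1
  rw [h1, powEquiv_apply, hval]
  refine CycloMap.div (CycloMap.sum fun i _ => CycloMap.mul ?_ (cycloMap_natCast k _))
    (cycloMap_natCast k _)
  rw [pow_one, pow_right_comm]
  exact (cycloMap_zeta k).pow i

/-- τ_k fixes the entries of M and permutes those of E by the power map; reindexing moves the
permutation onto M. -/
theorem cycloMap_trace_mul {F : IntermediateField ℚ ℂ} (hF : F ≤ cyclo (Monoid.exponent G))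
    {M E : Matrix G G ℂ} (hM : M ∈ biinvariant G) (hMF : ∀ a b, M a b ∈ F)
    (hE : E ∈ biinvariant G) (hi : IsIdempotentElem E)
    {k : (ZMod (Monoid.exponent G))ˣ} (hk : k ∈ ZF (Monoid.exponent G) hF) :
    CycloMap k (M * E).trace
      (Fintype.card G * ∑ g, M 1 ((powEquiv k).symm g) * E 1 g⁻¹) := by
  rw [trace_mul_eq hM hE]
  refine (cycloMap_natCast k _).mul ?_
  have : ∑ g, M 1 ((powEquiv k).symm g) * E 1 g⁻¹ = ∑ g, M 1 g * E 1 (powEquiv k g⁻¹) := by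
    refine (Fintype.sum_equiv (powEquiv k) _ _ fun g => ?_).symm
    rw [Equiv.symm_apply_apply, powEquiv_inv]
  rw [this]
  exact CycloMap.sum fun g _ => (cycloMap_self hF hk (hMF 1 g)).mul (cycloMap_idempotent hE hi k _)

/-- A biinvariant matrix with entries in `F` has its eigenvalues in `F` if and only if its entries
are invariant under the power maps of `Z_F`. -/
theorem eigenvaluesIn_iff {F : IntermediateField ℚ ℂ} (hF : F ≤ cyclo (Monoid.exponent G))
    {M : Matrix G G ℂ} (hM : M ∈ biinvariant G) (hMF : ∀ a b, M a b ∈ F) :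
    EigenvaluesIn M (F : Set ℂ) ↔
      ∀ k ∈ ZF (Monoid.exponent G) hF, ∀ g, M 1 (powEquiv k g) = M 1 g := by
  constructor
  · intro hev k hk g
    let M' : Matrix G G ℂ := circulant fun g => M 1 ((powEquiv k).symm g)
    have hM' : M' ∈ biinvariant G := circulant_mem_biinvariant fun g h hgh => by
      rw [powEquiv_symm]
      exact apply_one_eq_of_isConj hM (isConj_powEquiv _ hgh)
    have hM'1 : ∀ g, M' 1 g = M 1 ((powEquiv k).symm g) := fun g => by
      simp [M', circulant_apply]
    have hsub : M' - M = 0 := by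
      refine eq_zero_of_eigenvalues_eq_zero (biinvariant G)
        (fun Y => eq_zero_of_mem_biinvariant_of_sq) (sub_mem hM' hM) fun μ hμ => ?_
      obtain ⟨E, hE, hi, hE0, hEμ⟩ := exists_spectral_idempotent (biinvariant G)
        (fun Y => eq_zero_of_mem_biinvariant_of_sq) (sub_mem hM' hM) hμ
      have h1 := cycloMap_trace_mul hF hM hMF hE hi hk
      have h2 := cycloMap_self hF hk (hev.trace_mul_mem hi (biinvariant_comm hM hE))
      -- tr(M E) lies in F, hence is fixed by τ_k: this gives tr(M' E) = tr(M E), so μ tr E = 0.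
      have h3 := h1.right_unique h2
      simp only [← hM'1] at h3
      rw [← trace_mul_eq hM' hE] at h3
      have h4 := congrArg Matrix.trace hEμ
      rw [Matrix.sub_mul, Matrix.trace_sub, h3, sub_self, Matrix.trace_smul, smul_eq_mul] at h4
      exact (mul_eq_zero.1 h4.symm).resolve_right (trace_ne_zero_of_isIdempotentElem hi hE0)
    rw [← sub_eq_zero.1 hsub, hM'1, hM'1, Equiv.symm_apply_apply, ← hM'1, sub_eq_zero.1 hsub]
  · intro h μ hμ
    obtain ⟨E, hE, hi, hE0, hEμ⟩ := exists_spectral_idempotent (biinvariant G)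
        (fun Y => eq_zero_of_mem_biinvariant_of_sq) hM hμ
    have ht := trace_ne_zero_of_isIdempotentElem hi hE0
    obtain ⟨t, htt⟩ := exists_trace_eq_natCast_of_isIdempotentElem hi
    have h4 := congrArg Matrix.trace hEμ
    rw [Matrix.trace_smul, smul_eq_mul] at h4
    refine mem_of_cycloMap_self hF fun k hk => ?_
    have h1 := cycloMap_trace_mul hF hM hMF hE hi hk
    have h5 : ∀ g, M 1 ((powEquiv k).symm g) = M 1 g := fun g => by
      rw [powEquiv_symm]
      exact h _ (inv_mem hk) g
    simp only [h5] at h1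
    rw [← trace_mul_eq hM hE, h4] at h1
    -- μ is tr(M E) divided by the rank t of E, and τ_k fixes both.
    have h6 := h1.div (cycloMap_natCast k t)
    rwa [htt, mul_div_cancel_right₀ _ (by rwa [← htt])] at h6

end Criterion

/-! ### Class sums, their spans, and fusion of conjugacy classes. -/

section ClassSums

variable {G : Type*} [Group G] [Fintype G]

open Classical in
/-- The sum of the permutation matrices `A_h` over the class `{h | r h g}`. -/
def classSum (r : G → G → Prop) (g : G) : Matrix G G ℂ := ∑ h : G with r h g, permMat h

theorem mem_classMatrices {r : G → G → Prop} {A : Matrix G G ℂ} :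
    A ∈ classMatrices r ↔ ∃ g, classSum r g = A := by
  simp [classMatrices, classSum]

theorem classSum_mem (r : G → G → Prop) (g : G) : classSum r g ∈ classMatrices r :=
  mem_classMatrices.2 ⟨g, rfl⟩

theorem classSum_apply (r : G → G → Prop) (g a b : G) [Decidable (r (b * a⁻¹) g)] :
    classSum r g a b = if r (b * a⁻¹) g then 1 else 0 := by
  classical
  rw [classSum, Matrix.sum_apply]
  simp only [permMat_apply]
  rw [Finset.sum_ite_eq]
  simp

theorem classSum_eq_classSum_iff {r : G → G → Prop} (hr : Equivalence r) {g h : G} :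
    classSum r g = classSum r h ↔ r g h := by
  classical
  constructor
  · intro heq
    have := congrFun (congrFun heq 1) g
    rw [classSum_apply, classSum_apply] at this
    simp only [inv_one, mul_one, hr.refl g, if_true] at this
    by_contra hn
    simp [hn] at this
  · intro hgh
    ext a b
    rw [classSum_apply, classSum_apply]
    have : r (b * a⁻¹) g ↔ r (b * a⁻¹) h :=
      ⟨fun h1 => hr.trans h1 hgh, fun h1 => hr.trans h1 (hr.symm hgh)⟩
    simp only [this]

theorem sum_apply_of_subset_classMatrices {r : G → G → Prop} (hr : Equivalence r)
    {p : Finset (Matrix G G ℂ)} (hp : p ⊆ classMatrices r) (a b : G)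
    [Decidable (classSum r (b * a⁻¹) ∈ p)] :
    (∑ A ∈ p, A) a b = if classSum r (b * a⁻¹) ∈ p then 1 else 0 := by
  classical
  rw [Matrix.sum_apply]
  have h : ∀ A ∈ p, A a b = if classSum r (b * a⁻¹) = A then 1 else 0 := by
    intro A hA
    obtain ⟨g, rfl⟩ := mem_classMatrices.1 (hp hA)
    rw [classSum_apply]
    simp only [classSum_eq_classSum_iff hr]
  rw [Finset.sum_congr rfl h, Finset.sum_ite_eq]
  congr

/-- The coefficient ring is general because spans over ℂ, L and F are all needed. -/
theorem mem_span_classMatrices_iff {K : Type*} [CommRing K] [Algebra K ℂ] {r : G → G → Prop}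
    (hr : Equivalence r) {M : Matrix G G ℂ} :
    M ∈ Submodule.span K (classMatrices r : Set (Matrix G G ℂ)) ↔
      ∃ m : G → K, (∀ g h, r g h → m g = m h) ∧ M = circulant fun g => algebraMap K ℂ (m g) := by
  classical
  constructor
  · intro hM
    induction hM using Submodule.span_induction with
    | mem A hA =>
      obtain ⟨g, rfl⟩ := mem_classMatrices.1 (Finset.mem_coe.1 hA)
      refine ⟨fun x => if r x g then 1 else 0, fun x y hxy => ?_, ?_⟩
      · have : r x g ↔ r y g := ⟨hr.trans (hr.symm hxy), hr.trans hxy⟩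
        simp only [this]
      · ext a b
        rw [classSum_apply, circulant_apply]
        split_ifs with h <;> simp [h]
    | zero => exact ⟨0, fun _ _ _ => rfl, by ext; simp [circulant_apply]⟩
    | add A B _ _ hA hB =>
      obtain ⟨m, hm, rfl⟩ := hA
      obtain ⟨m', hm', rfl⟩ := hB
      exact ⟨m + m', fun x y h => by simp [hm x y h, hm' x y h],
        by ext; simp [circulant_apply]⟩
    | smul c A _ hA =>
      obtain ⟨m, hm, rfl⟩ := hA
      exact ⟨c • m, fun x y h => by simp [hm x y h],
        by ext; simp [circulant_apply, Algebra.smul_def]⟩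
  · rintro ⟨m, hm, rfl⟩
    let s : Setoid G := ⟨r, hr⟩
    have : circulant (fun g => algebraMap K ℂ (m g)) =
        ∑ q : Quotient s, m q.out • classSum r q.out := by
      ext a b
      rw [Matrix.sum_apply, Finset.sum_eq_single (⟦b * a⁻¹⟧ : Quotient s)]
      · have hout : r (b * a⁻¹) (⟦b * a⁻¹⟧ : Quotient s).out := hr.symm (Quotient.mk_out (s := s) _)
        rw [Matrix.smul_apply, classSum_apply, if_pos hout, circulant_apply, hm _ _ hout,
          Algebra.smul_def, mul_one]
      · intro q _ hq
        rw [Matrix.smul_apply, classSum_apply, if_neg, smul_zero]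
        intro h
        exact hq ((Quotient.out_eq q).symm.trans (Quotient.sound (s := s) (hr.symm h)))
      · simp
    rw [this]
    exact Submodule.sum_mem _ fun q _ =>
      Submodule.smul_mem _ _ (Submodule.subset_span (Finset.mem_coe.2 (classSum_mem r _)))

theorem mem_span_classMatrices_iff_of_intermediateField (K : IntermediateField ℚ ℂ)
    {r : G → G → Prop} (hr : Equivalence r) {M : Matrix G G ℂ} :
    M ∈ Submodule.span K (classMatrices r : Set (Matrix G G ℂ)) ↔
      M = circulant (M 1) ∧ (∀ g h, r g h → M 1 g = M 1 h) ∧ ∀ g, M 1 g ∈ K := by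
  rw [mem_span_classMatrices_iff hr]
  constructor
  · rintro ⟨m, hm, rfl⟩
    refine ⟨by ext; simp [circulant_apply], fun g h hgh => ?_, fun g => ?_⟩
    · simp [circulant_apply, hm g h hgh]
    · simp [circulant_apply]
  · rintro ⟨h1, h2, h3⟩
    refine ⟨fun g => ⟨M 1 g, h3 g⟩, fun g h hgh => Subtype.ext (h2 g h hgh), h1⟩

variable [DecidableEq G]

theorem classSum_mem_biinvariant {r : G → G → Prop} (hr : Equivalence r)
    (hconj : ∀ g h, IsConj g h → r g h) (g : G) : classSum r g ∈ biinvariant G := by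
  classical
  have : classSum r g = circulant fun x => if r x g then 1 else 0 := by
    ext a b
    rw [classSum_apply, circulant_apply]
  rw [this]
  refine circulant_mem_biinvariant fun x y hxy => ?_
  have : r x g ↔ r y g := ⟨hr.trans (hr.symm (hconj _ _ hxy)), hr.trans (hconj _ _ hxy)⟩
  simp only [this]

theorem isAssociationScheme_classMatrices {r : G → G → Prop} (hr : Equivalence r)
    (hconj : ∀ g h, IsConj g h → r g h) (hone : ∀ g, r g 1 → g = 1)
    (hinv : ∀ g h, r g h → r g⁻¹ h⁻¹)
    (hmul : ∀ x y g h, r g h →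
      (classSum r x * classSum r y) 1 g = (classSum r x * classSum r y) 1 h) :
    IsAssociationScheme (classMatrices r) := by
  classical
  refine ⟨?_, ?_, ?_, ?_, ?_, ?_, ?_⟩
  · intro A hA a b
    obtain ⟨g, rfl⟩ := mem_classMatrices.1 hA
    rw [classSum_apply]
    split_ifs <;> simp
  · intro A hA h0
    obtain ⟨g, rfl⟩ := mem_classMatrices.1 hA
    have := congrFun (congrFun h0 1) g
    rw [classSum_apply] at this
    simp [hr.refl g] at this
  · refine mem_classMatrices.2 ⟨1, ?_⟩
    ext a b
    have : r (b * a⁻¹) 1 ↔ a = b := by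
      refine ⟨fun h => (mul_inv_eq_one.1 (hone _ h)).symm, ?_⟩
      rintro rfl
      rw [mul_inv_cancel]
      exact hr.refl 1
    rw [classSum_apply, Matrix.one_apply]
    simp only [this]
  · ext a b
    rw [sum_apply_of_subset_classMatrices hr (Finset.Subset.refl _), if_pos (classSum_mem r _)]
    rfl
  · intro A hA
    obtain ⟨g, rfl⟩ := mem_classMatrices.1 hA
    refine mem_classMatrices.2 ⟨g⁻¹, ?_⟩
    ext a b
    rw [Matrix.transpose_apply, classSum_apply, classSum_apply]
    have : r (b * a⁻¹) g⁻¹ ↔ r (a * b⁻¹) g :=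
      ⟨fun h => by simpa using hinv _ _ h, fun h => by simpa using hinv _ _ h⟩
    simp only [this]
  · intro A hA B hB
    obtain ⟨g, rfl⟩ := mem_classMatrices.1 hA
    obtain ⟨h, rfl⟩ := mem_classMatrices.1 hB
    exact biinvariant_comm (classSum_mem_biinvariant hr hconj g) (classSum_mem_biinvariant hr hconj h)
  · intro A hA B hB
    obtain ⟨g, rfl⟩ := mem_classMatrices.1 hA
    obtain ⟨h, rfl⟩ := mem_classMatrices.1 hB
    exact (mem_span_classMatrices_iff hr).2 ⟨_, hmul g h, eq_circulant_of_mem_biinvariant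
      (mul_mem (classSum_mem_biinvariant hr hconj g) (classSum_mem_biinvariant hr hconj h))⟩

theorem isAssociationScheme_conjScheme : IsAssociationScheme (conjScheme G) := by
  have hr : Equivalence (IsConj : G → G → Prop) :=
    ⟨IsConj.refl, IsConj.symm, IsConj.trans⟩
  refine isAssociationScheme_classMatrices hr (fun _ _ => id) (fun g h => isConj_one_right.1 h.symm)
    (fun g h hgh => ?_) fun x y g h hgh => ?_
  · obtain ⟨c, rfl⟩ := isConj_iff.1 hgh
    exact isConj_iff.2 ⟨c, by group⟩
  · exact apply_one_eq_of_isConj (mul_mem (classSum_mem_biinvariant hr (fun _ _ => id) x)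
      (classSum_mem_biinvariant hr (fun _ _ => id) y)) hgh

/-- Merging conjugacy classes along a coarser relation gives a subscheme as soon as it gives an
association scheme. -/
theorem isSubscheme_conjScheme {r : G → G → Prop} (hr : Equivalence r)
    (hconj : ∀ g h, IsConj g h → r g h) (hone : ∀ g, r g 1 → g = 1)
    (hS : IsAssociationScheme (classMatrices r)) : IsSubscheme (classMatrices r) (conjScheme G) := by
  classical
  have hc : Equivalence (IsConj : G → G → Prop) :=
    ⟨IsConj.refl, IsConj.symm, IsConj.trans⟩
  refine ⟨isAssociationScheme_conjScheme, hS, ?_⟩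
  -- The block of g collects the conjugacy class sums contained in its r-class.
  let part : G → Finset (Matrix G G ℂ) := fun g =>
    {A ∈ conjScheme G | ∃ h, r h g ∧ classSum IsConj h = A}
  have hmem : ∀ x g, classSum IsConj x ∈ part g ↔ r x g := by
    intro x g
    simp only [part, Finset.mem_filter]
    constructor
    · rintro ⟨-, h, hh, heq⟩
      exact hr.trans (hconj _ _ ((classSum_eq_classSum_iff hc).1 heq.symm)) hh
    · exact fun h => ⟨classSum_mem _ _, x, h, rfl⟩
  have hsub : ∀ g, part g ⊆ conjScheme G := fun g => Finset.filter_subset _ _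
  have hext : ∀ g h, r g h → part g = part h := by
    intro g h hgh
    refine Finset.filter_congr fun A _ => ?_
    exact ⟨fun ⟨x, hx, e⟩ => ⟨x, hr.trans hx hgh, e⟩,
      fun ⟨x, hx, e⟩ => ⟨x, hr.trans hx (hr.symm hgh), e⟩⟩
  have hsum : ∀ g, ∑ A ∈ part g, A = classSum r g := by
    intro g
    ext a b
    rw [sum_apply_of_subset_classMatrices hc (hsub g), classSum_apply]
    simp only [hmem]
  have h1 : classSum IsConj (1 : G) = 1 := by
    ext a b
    rw [classSum_apply, Matrix.one_apply]
    have : IsConj (b * a⁻¹) 1 ↔ a = b := by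
      rw [isConj_comm, isConj_one_right, mul_inv_eq_one, eq_comm]
    simp only [this]
  refine ⟨Finpartition.ofExistsUnique (Finset.univ.image part) ?_ ?_ ?_, ?_, ?_⟩
  · intro p hp
    obtain ⟨g, -, rfl⟩ := Finset.mem_image.1 hp
    exact hsub g
  · intro A hA
    obtain ⟨g, rfl⟩ := mem_classMatrices.1 hA
    refine ⟨part g, ⟨Finset.mem_image_of_mem _ (Finset.mem_univ g), (hmem g g).2 (hr.refl g)⟩, ?_⟩
    rintro p ⟨hp, hgp⟩
    obtain ⟨h, -, rfl⟩ := Finset.mem_image.1 hp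
    exact (hext _ _ ((hmem g h).1 hgp)).symm
  · intro h
    obtain ⟨g, -, hg⟩ := Finset.mem_image.1 h
    exact Finset.notMem_empty (classSum IsConj g) (hg ▸ (hmem g g).2 (hr.refl g))
  · refine Finset.mem_image.2 ⟨1, Finset.mem_univ _, ?_⟩
    ext A
    rw [Finset.mem_singleton]
    constructor
    · intro hA
      obtain ⟨x, rfl⟩ := mem_classMatrices.1 (hsub 1 hA)
      rw [hone x ((hmem x 1).1 hA), h1]
    · rintro rfl
      rw [← h1]
      exact (hmem 1 1).2 (hr.refl 1)
  · ext A
    simp [mem_classMatrices, Finpartition.ofExistsUnique, hsum]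

end ClassSums

/-! ### The relation ∼_F and its scheme. -/

section SimF

variable {G : Type*} [Group G] [Fintype G] {F : IntermediateField ℚ ℂ}
  (hF : F ≤ cyclo (Monoid.exponent G))

theorem simF_iff {g h : G} :
    SimF hF g h ↔ ∃ k ∈ ZF (Monoid.exponent G) hF, IsConj g (powEquiv k h) := Iff.rfl

omit [Fintype G] in
theorem powEquiv_one (g : G) : powEquiv 1 g = g := pow_val_one g

theorem equivalence_simF : Equivalence (SimF (G := G) hF) := by
  refine ⟨fun g => ⟨1, one_mem _, by rw [pow_val_one]⟩, ?_, ?_⟩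
  · rintro g h ⟨k, hk, hgh⟩
    refine (simF_iff hF).2 ⟨k⁻¹, inv_mem hk, ?_⟩
    have := isConj_powEquiv k⁻¹ hgh
    rw [← powEquiv_apply, powEquiv_powEquiv, mul_inv_cancel, powEquiv_one] at this
    exact this.symm
  · rintro g h x ⟨k, hk, hgh⟩ ⟨l, hl, hhx⟩
    refine (simF_iff hF).2 ⟨l * k, mul_mem hl hk, IsConj.trans hgh ?_⟩
    rw [← powEquiv_powEquiv]
    exact isConj_powEquiv k hhx

theorem simF_of_isConj {g h : G} (hgh : IsConj g h) : SimF hF g h :=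
  ⟨1, one_mem _, by rwa [pow_val_one]⟩

theorem simF_powEquiv {k : (ZMod (Monoid.exponent G))ˣ} (hk : k ∈ ZF (Monoid.exponent G) hF)
    (g : G) : SimF hF (powEquiv k g) g := ⟨k, hk, IsConj.refl _⟩

theorem eq_one_of_simF_one {g : G} (h : SimF hF g 1) : g = 1 := by
  obtain ⟨k, -, h⟩ := (simF_iff hF).1 h
  rw [powEquiv_one_right] at h
  exact isConj_one_right.1 h.symm

theorem simF_inv {g h : G} (hgh : SimF hF g h) : SimF hF g⁻¹ h⁻¹ := by
  obtain ⟨k, hk, hgh⟩ := (simF_iff hF).1 hgh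
  refine (simF_iff hF).2 ⟨k, hk, ?_⟩
  obtain ⟨c, hc⟩ := isConj_iff.1 hgh
  exact isConj_iff.2 ⟨c, by rw [powEquiv_inv, ← hc]; group⟩

variable [DecidableEq G]

theorem eigenvaluesIn_iff_forall_simF {M : Matrix G G ℂ} (hM : M ∈ biinvariant G)
    (hMF : ∀ a b, M a b ∈ F) :
    EigenvaluesIn M (F : Set ℂ) ↔ ∀ g h, SimF hF g h → M 1 g = M 1 h := by
  rw [eigenvaluesIn_iff hF hM hMF]
  constructor
  · rintro h g x ⟨k, hk, hgx⟩
    rw [apply_one_eq_of_isConj hM hgx]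
    exact h k hk x
  · exact fun h k hk g => h _ _ (simF_powEquiv hF hk g)

omit [DecidableEq G] in
theorem classSum_apply_mem (r : G → G → Prop) (g a b : G) : classSum r g a b ∈ F := by
  classical
  rw [classSum_apply]
  split_ifs
  exacts [F.one_mem, F.zero_mem]

/-- Closure under products needs no structure constants: the product of two class sums has entries
and eigenvalues in F, so the criterion makes it constant on classes. -/
theorem isAssociationScheme_simF :
    IsAssociationScheme (classMatrices (SimF (G := G) hF)) := by
  classical
  have hr := equivalence_simF (G := G) hF
  have hb := classSum_mem_biinvariant hr (fun _ _ => simF_of_isConj hF)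
  refine isAssociationScheme_classMatrices hr (fun _ _ => simF_of_isConj hF)
    (fun _ => eq_one_of_simF_one hF) (fun _ _ => simF_inv hF) fun x y => ?_
  have hev : ∀ x, EigenvaluesIn (classSum (SimF hF) x) (F : Set ℂ) := fun x =>
    (eigenvaluesIn_iff_forall_simF hF (hb x) (classSum_apply_mem _ x)).2 fun g h hgh => by
      rw [classSum_apply, classSum_apply]
      have : SimF hF (g * 1⁻¹) x ↔ SimF hF (h * 1⁻¹) x := by
        rw [inv_one, mul_one, mul_one]
        exact ⟨hr.trans (hr.symm hgh), hr.trans hgh⟩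
      simp only [this]
  refine (eigenvaluesIn_iff_forall_simF hF (mul_mem (hb x) (hb y)) fun a b => ?_).1
    ((hev x).mul (hev y) (biinvariant_comm (hb x) (hb y)))
  rw [Matrix.mul_apply]
  exact sum_mem fun c _ => F.mul_mem (classSum_apply_mem _ _ _ _) (classSum_apply_mem _ _ _ _)

theorem matricesOver_conjScheme :
    matricesOver (cyclo (Monoid.exponent G)) F (conjScheme G) =
      (Submodule.span F (classMatrices (SimF (G := G) hF) : Set (Matrix G G ℂ)) :
        Set (Matrix G G ℂ)) := by
  have hc : Equivalence (IsConj : G → G → Prop) :=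
    ⟨IsConj.refl, IsConj.symm, IsConj.trans⟩
  ext M
  rw [SetLike.mem_coe, mem_span_classMatrices_iff_of_intermediateField F (equivalence_simF hF),
    matricesOver, Set.mem_ofPred_eq, conjScheme,
    mem_span_classMatrices_iff_of_intermediateField _ hc]
  constructor
  · rintro ⟨⟨h1, h2, -⟩, h3, h4⟩
    have hM : M ∈ biinvariant G := h1 ▸ circulant_mem_biinvariant h2
    exact ⟨h1, (eigenvaluesIn_iff_forall_simF hF hM h3).1 h4, h3 1⟩
  · rintro ⟨h1, h2, h3⟩
    have h2' : ∀ g h, IsConj g h → M 1 g = M 1 h := fun g h hgh => h2 g h (simF_of_isConj hF hgh)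
    have hM : M ∈ biinvariant G := h1 ▸ circulant_mem_biinvariant h2'
    have h3' : ∀ a b, M a b ∈ F := fun a b => by
      rw [apply_eq_of_mem_biinvariant hM]
      exact h3 _
    exact ⟨⟨h1, h2', fun g => hF (h3 g)⟩, h3', (eigenvaluesIn_iff_forall_simF hF hM h3').2 h2⟩

omit [Group G] [Fintype G] [DecidableEq G] in
theorem isUnionOfClasses_iff {r : G → G → Prop} (hr : Equivalence r) (C : Set G) :
    IsUnionOfClasses r C ↔ ∀ g h, r g h → (g ∈ C ↔ h ∈ C) := by
  constructor
  · rintro ⟨T, rfl⟩ g h hgh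
    simp only [Set.mem_iUnion, Set.mem_ofPred_eq, exists_prop]
    exact ⟨fun ⟨x, hx, h'⟩ => ⟨x, hx, hr.trans (hr.symm hgh) h'⟩,
      fun ⟨x, hx, h'⟩ => ⟨x, hx, hr.trans hgh h'⟩⟩
  · intro h
    refine ⟨C, Set.ext fun x => ?_⟩
    simp only [Set.mem_iUnion, Set.mem_ofPred_eq, exists_prop]
    exact ⟨fun hx => ⟨x, hx, hr.refl x⟩, fun ⟨y, hy, hxy⟩ => (h x y hxy).2 hy⟩

theorem eigenvaluesIn_cayleyDigraph_iff {C : Set G} (hC : IsUnionOfClasses IsConj C) :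
    EigenvaluesIn (adjacencyMatrix (cayleyDigraph C)) (F : Set ℂ) ↔
      IsUnionOfClasses (SimF hF) C := by
  classical
  rw [isUnionOfClasses_iff ⟨IsConj.refl, IsConj.symm, IsConj.trans⟩] at hC
  have happ : adjacencyMatrix (cayleyDigraph C) = circulant fun g => if g ∈ C then 1 else 0 := by
    ext a b
    simp only [adjacencyMatrix, cayleyDigraph, circulant_apply, Matrix.of_apply]
    congr
  have hM : adjacencyMatrix (cayleyDigraph C) ∈ biinvariant G := by
    rw [happ]
    exact circulant_mem_biinvariant fun g h hgh => by simp only [hC g h hgh]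
  -- Entries 0 and 1 lie in any F, so the criterion applies and says that the indicator of C is
  -- constant on classes.
  rw [isUnionOfClasses_iff (equivalence_simF hF), eigenvaluesIn_iff_forall_simF hF hM]
  · refine forall₃_congr fun g h _ => ?_
    simp only [happ, circulant_apply, inv_one, mul_one]
    by_cases h1 : g ∈ C <;> by_cases h2 : h ∈ C <;> simp [h1, h2]
  · intro a b
    rw [happ, circulant_apply]
    split_ifs
    exacts [F.one_mem, F.zero_mem]

end SimF

end GroupScheme

end

theorem mainTheorem5 {G : Type*} [Group G] [Fintype G] [DecidableEq G]
    (F : IntermediateField ℚ ℂ) (hF : F ≤ GroupScheme.cyclo (Monoid.exponent G)) :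
    Equivalence (GroupScheme.SimF (G := G) hF) ∧
    GroupScheme.IsSubscheme (GroupScheme.classMatrices (GroupScheme.SimF (G := G) hF))
      (GroupScheme.conjScheme G) ∧
    GroupScheme.matricesOver (GroupScheme.cyclo (Monoid.exponent G)) F
        (GroupScheme.conjScheme G) =
      (Submodule.span F
        (GroupScheme.classMatrices (GroupScheme.SimF (G := G) hF) : Set (Matrix G G ℂ)) :
          Set (Matrix G G ℂ)) ∧
    ∀ C : Set G, GroupScheme.IsUnionOfClasses IsConj C →
      (GroupScheme.EigenvaluesIn
          (GroupScheme.adjacencyMatrix (GroupScheme.cayleyDigraph C)) (F : Set ℂ) ↔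
        GroupScheme.IsUnionOfClasses (GroupScheme.SimF hF) C) := by
  exact ⟨GroupScheme.equivalence_simF hF,
    GroupScheme.isSubscheme_conjScheme (GroupScheme.equivalence_simF hF)
      (fun _ _ => GroupScheme.simF_of_isConj hF) (fun _ => GroupScheme.eq_one_of_simF_one hF)
      (GroupScheme.isAssociationScheme_simF hF),
    GroupScheme.matricesOver_conjScheme hF,
    fun _ hC => GroupScheme.eigenvaluesIn_cayleyDigraph_iff hF hC⟩
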